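/- Let $\mathbb K=\mathbb R$ or $\mathbb C$, let $n\ge 1$, and let $s\in\mathbb K$. Write $E_{ij}$ for the matrix units of $\mathfrak{gl}_n(\mathbb K)$, and set $X_k=E_{k,k+1}$, $Y_k=E_{k+1,k}$ for $1\le k\le n-1$. Let $B_{n+1}$ be the braid group with generators $\sigma_1,\dots,\sigma_n$ and relations $\sigma_i\sigma_{i+1}\sigma_i=\sigma_{i+1}\sigma_i\sigma_{i+1}$ and $\sigma_i\sigma_j=\sigma_j\sigma_i$ for $|i-j|\ge 2$. (1) Let $\pi:\mathfrak{gl}_n(\mathbb K)\to \mathrm{End}(V)$ be any representation of the Lie algebra $\mathfrak{gl}_n(\mathbb K)$ by bounded operators on a Banach space $V$ over $\mathbb K$ (for instance, any representation on a finite-dimensional space). Then there is a group homomorphism $\rho^{\pi}_{n+1}:B_{n+1}\to \mathrm{GL}(V)$ with $$\rho^{\pi}_{n+1}(\sigma_1)=\exp(s\pi(E_{11}))\exp(-\pi(X_1)),$$ $$\rho^{\pi}_{n+1}(\sigma_k)=\exp(\pi(Y_{k-1}))\exp(s\pi(E_{kk}))\exp(-\pi(X_k)),\qquad 2\le k\le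 n-1,$$ $$\rho^{\pi}_{n+1}(\sigma_n)=\exp(\pi(Y_{n-1}))\exp(s\pi(E_{nn})).$$ (For $n=1$ the only formula is $\rho^{\pi}_2(\sigma_1)=\exp(s\pi(E_{11}))$.) (2) Let $t\in\mathbb K\setminus\{0\}$ satisfy $e^s=-t$ (for instance, $t<0$ and $s=\ln(-t)$), and let $\pi$ be the natural representation of $\mathfrak{gl}_n(\mathbb K)$ on $\mathbb K^n$. Then $\rho^{\pi}_{n+1}$ is the reduced Burau representation $\rho^{(t)}_{n+1}:B_{n+1}\to \mathrm{GL}_n(\mathbb K)$, that is, the representation $$\sigma_1\mapsto \begin{pmatrix}-t&t\\0&1\end{pmatrix}\oplus I_{n-2},\qquad \sigma_k\mapsto I_{k-2}\oplus\begin{pmatrix}1&0&0\\1&-t&t\\0&0&1\end{pmatrix}\oplus I_{n-k-1}\ \ (2\le k\le n-1),\qquad \sigma_n\mapsto I_{n-2}\oplus\begin{pmatrix}1&0\\1&-t\end{pmatrix}$$ (for $n=1$, $\sigma_1\mapsto(-t)$). -/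

import Mathlib

attribute [local instance 100] LieRing.ofAssociativeRing

/-- The relators of Artin's presentation of the braid group on `m` strands; the generators
`σ_1, …, σ_{m-1}` are indexed by `Fin (m - 1)`, counting from `0`. -/
inductive BraidRelator (m : ℕ) : FreeGroup (Fin (m - 1)) → Prop
  | braid (i j : Fin (m - 1)) (h : (i : ℕ) + 1 = j) :
      BraidRelator m
        (FreeGroup.of i * FreeGroup.of j * FreeGroup.of i *
          (FreeGroup.of j * FreeGroup.of i * FreeGroup.of j)⁻¹)
  | comm (i j : Fin (m - 1)) (h : (i : ℕ) + 2 ≤ j) :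
      BraidRelator m
        (FreeGroup.of i * FreeGroup.of j * (FreeGroup.of j * FreeGroup.of i)⁻¹)

/-- The braid group `B_m` on `m` strands. -/
abbrev BraidGroup (m : ℕ) : Type := PresentedGroup {r | BraidRelator m r}

/-- The standard generators of `B_{n+1}`: `BraidGroup.σ k` is `σ_{k+1}` in the usual numbering
`σ_1, …, σ_n`. -/
def BraidGroup.σ {n : ℕ} (k : Fin n) : BraidGroup (n + 1) :=
  PresentedGroup.of (rels := {r | BraidRelator (n + 1) r}) k

section Burau

variable {R : Type*} [CommRing R] {n : ℕ}

/-- The row `(0, …, 0, 1, -t, t, 0, …, 0)` with `-t` in position `k`; entries that fall outside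
the range are dropped. -/
def burauRow (t : R) (k : Fin n) : Fin n → R := fun j =>
  if (j : ℕ) + 1 = k then 1 else if j = k then -t else if (j : ℕ) = k + 1 then t else 0

/-- The reduced Burau matrix of a standard generator: the identity matrix with row `k` replaced by
`(0, …, 0, 1, -t, t, 0, …, 0)`. -/
def burauMatrix (t : R) (k : Fin n) : Matrix (Fin n) (Fin n) R :=
  (1 : Matrix (Fin n) (Fin n) R).updateRow k (burauRow t k)

/-- The difference between a reduced Burau matrix and the identity. -/
def burauDiff (t : R) (k : Fin n) : Matrix (Fin n) (Fin n) R :=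
  Matrix.vecMulVec (Pi.single k 1) (burauRow t k - Pi.single k 1)

theorem burauMatrix_eq (t : R) (k : Fin n) : burauMatrix t k = 1 + burauDiff t k := by
  ext i j
  by_cases h : i = k
  · subst h
    simp [burauMatrix, burauDiff, Matrix.vecMulVec_apply, Matrix.one_apply, Pi.single_apply,
      eq_comm]
  · simp [burauMatrix, burauDiff, Matrix.vecMulVec_apply, h]

theorem burauDiff_mul (t : R) (k l : Fin n) :
    burauDiff t k * burauDiff t l =
      (burauRow t k l - (Pi.single k 1 : Fin n → R) l) •
        Matrix.vecMulVec (Pi.single k 1) (burauRow t l - Pi.single l 1) := by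
  rw [burauDiff, burauDiff, Matrix.vecMulVec_mul_vecMulVec]
  ext i j
  simp [Matrix.vecMulVec_apply]
  ring

theorem burauDiff_sq (t : R) (k : Fin n) :
    burauDiff t k * burauDiff t k = (-t - 1) • burauDiff t k := by
  rw [burauDiff_mul]
  simp [burauRow, burauDiff]

theorem burauDiff_mul_mul (t : R) (k l : Fin n) (h : (k : ℕ) + 1 = l ∨ (l : ℕ) + 1 = k) :
    burauDiff t k * burauDiff t l * burauDiff t k = t • burauDiff t k := by
  have hkl : k ≠ l := by rintro rfl; omega
  have e : burauRow t k l * burauRow t l k = t := by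
    simp only [burauRow, Fin.ext_iff]
    rcases h with h | h
    · rw [if_neg (by omega), if_neg (by omega), if_pos (by omega), if_pos (by omega), mul_one]
    · rw [if_pos (by omega), if_neg (by omega), if_neg (by omega), if_pos (by omega), one_mul]
  rw [burauDiff_mul, burauDiff, Matrix.smul_mul, Matrix.vecMulVec_mul_vecMulVec]
  ext i j
  simp only [Matrix.smul_apply, Matrix.vecMulVec_apply, Pi.smul_apply, smul_eq_mul,
    dotProduct_single, Pi.sub_apply, Pi.single_eq_of_ne hkl, Pi.single_eq_of_ne hkl.symm]
  linear_combination
    (Pi.single k 1 : Fin n → R) i * (burauRow t k j - (Pi.single k 1 : Fin n → R) j) * e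

theorem burauMatrix_braid (t : R) (k l : Fin n) (h : (k : ℕ) + 1 = l) :
    burauMatrix t k * burauMatrix t l * burauMatrix t k =
      burauMatrix t l * burauMatrix t k * burauMatrix t l := by
  have h1 := burauDiff_mul_mul t k l (Or.inl h)
  have h2 := burauDiff_mul_mul t l k (Or.inr h)
  have h3 := burauDiff_sq t k
  have h4 := burauDiff_sq t l
  have e : ∀ P Q : Matrix (Fin n) (Fin n) R, P * P = (-t - 1) • P → P * Q * P = t • P →
      (1 + P) * (1 + Q) * (1 + P) = 1 + P + Q + P * Q + Q * P := by
    intro P Q hP hQ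
    have : (1 + P) * (1 + Q) * (1 + P) =
        1 + P + P + Q + P * Q + Q * P + P * P + P * Q * P := by noncomm_ring
    rw [this, hP, hQ]
    module
  rw [burauMatrix_eq, burauMatrix_eq, e _ _ h3 h1, e _ _ h4 h2]
  abel

theorem burauMatrix_comm (t : R) (k l : Fin n) (h : (k : ℕ) + 2 ≤ l) :
    burauMatrix t k * burauMatrix t l = burauMatrix t l * burauMatrix t k := by
  have hkl : k ≠ l := by rintro rfl; omega
  have h1 : burauDiff t k * burauDiff t l = 0 := by
    rw [burauDiff_mul, Pi.single_eq_of_ne hkl.symm, burauRow, if_neg (by omega),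
      if_neg (by omega), if_neg (by omega), sub_zero, zero_smul]
  have h2 : burauDiff t l * burauDiff t k = 0 := by
    rw [burauDiff_mul, Pi.single_eq_of_ne hkl, burauRow, if_neg (by omega),
      if_neg (by omega), if_neg (by omega), sub_zero, zero_smul]
  have e : ∀ P Q : Matrix (Fin n) (Fin n) R, P * Q = 0 → (1 + P) * (1 + Q) = 1 + P + Q := by
    intro P Q hPQ
    rw [mul_add, mul_one, add_mul, one_mul, hPQ, add_zero]
  rw [burauMatrix_eq, burauMatrix_eq, e _ _ h1, e _ _ h2]
  abel

theorem burauMatrix_mul_inv (t : Rˣ) (k : Fin n) :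
    burauMatrix (t : R) k * (1 + ((t⁻¹ : Rˣ) : R) • burauDiff (t : R) k) = 1 := by
  rw [burauMatrix_eq, add_mul, one_mul, mul_add, mul_one, Matrix.mul_smul, burauDiff_sq, smul_smul]
  have : ((t⁻¹ : Rˣ) : R) * (-(t : R) - 1) = -1 - ((t⁻¹ : Rˣ) : R) := by
    rw [mul_sub, mul_neg, Units.inv_mul, mul_one]
  rw [this]
  module

/-- The reduced Burau matrix of a standard generator, as an element of `GL_n(R)`. -/
def burauGL (t : Rˣ) (k : Fin n) : Matrix.GeneralLinearGroup (Fin n) R where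
  val := burauMatrix (t : R) k
  inv := 1 + ((t⁻¹ : Rˣ) : R) • burauDiff (t : R) k
  val_inv := burauMatrix_mul_inv t k
  inv_val := mul_eq_one_comm.mp (burauMatrix_mul_inv t k)

/-- The reduced Burau representation `B_{n+1} → GL_n(R)` with parameter `t`. It sends `σ_1` to
`[-t, t; 0, 1] ⊕ I`, `σ_n` to `I ⊕ [1, 0; 1, -t]`, and the other generators to
`I ⊕ [1, 0, 0; 1, -t, t; 0, 0, 1] ⊕ I`. -/
def reducedBurau (n : ℕ) (t : Rˣ) :
    BraidGroup (n + 1) →* Matrix.GeneralLinearGroup (Fin n) R :=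
  PresentedGroup.toGroup (rels := {r | BraidRelator (n + 1) r}) (f := fun k : Fin n => burauGL t k)
    (by
      rintro r (⟨i, j, h⟩ | ⟨i, j, h⟩)
      · simp only [map_mul, map_inv, FreeGroup.lift_apply_of, mul_inv_eq_one]
        exact Units.ext (burauMatrix_braid (n := n) (t : R) i j h)
      · simp only [map_mul, map_inv, FreeGroup.lift_apply_of, mul_inv_eq_one]
        exact Units.ext (burauMatrix_comm (n := n) (t : R) i j h))

theorem reducedBurau_σ (t : Rˣ) (k : Fin n) :
    (reducedBurau n t (BraidGroup.σ k) : Matrix (Fin n) (Fin n) R) = burauMatrix (t : R) k :=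
  congrArg Units.val (PresentedGroup.toGroup.of (rels := {r | BraidRelator (n + 1) r}) _)

end Burau

section Representation

variable {𝕜 : Type*} [RCLike 𝕜] {n : ℕ}

/-- The matrix unit `E_{kk}`. -/
def glE (𝕜 : Type*) [RCLike 𝕜] {n : ℕ} (k : Fin n) : Matrix (Fin n) (Fin n) 𝕜 :=
  Matrix.single k k 1

/-- The Serre generator `E_{k,k+1}` (the index `k` counts from `0`). -/
def serreX (𝕜 : Type*) [RCLike 𝕜] {n : ℕ} (k : ℕ) (h : k + 1 < n) : Matrix (Fin n) (Fin n) 𝕜 :=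
  Matrix.single ⟨k, Nat.lt_of_succ_lt h⟩ ⟨k + 1, h⟩ 1

/-- The Serre generator `E_{k+1,k}` (the index `k` counts from `0`). -/
def serreY (𝕜 : Type*) [RCLike 𝕜] {n : ℕ} (k : ℕ) (h : k + 1 < n) : Matrix (Fin n) (Fin n) 𝕜 :=
  Matrix.single ⟨k + 1, h⟩ ⟨k, Nat.lt_of_succ_lt h⟩ 1

/-- The operator `exp(π(Y_{k-1})) exp(s π(E_{kk})) exp(-π(X_k))` attached to the generator `σ_k`;
the first factor is absent for the first generator and the last factor is absent for the last
generator. -/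
noncomputable def braidOperator {V : Type*} [NormedAddCommGroup V] [NormedSpace 𝕜 V]
    (π : Matrix (Fin n) (Fin n) 𝕜 →ₗ⁅𝕜⁆ (V →L[𝕜] V)) (s : 𝕜) (k : Fin n) : V →L[𝕜] V :=
  (if h : 0 < (k : ℕ) then
      NormedSpace.exp (π (serreY 𝕜 ((k : ℕ) - 1) (by rw [Nat.sub_add_cancel h]; exact k.2)))
    else 1) *
    NormedSpace.exp (s • π (glE 𝕜 k)) *
    (if h : (k : ℕ) + 1 < n then NormedSpace.exp (-π (serreX 𝕜 (k : ℕ) h)) else 1)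

/-- The natural representation of `gl_n` on `𝕜^n`: a matrix acts by multiplication on column
vectors. -/
noncomputable def naturalRep (𝕜 : Type*) [RCLike 𝕜] (n : ℕ) :
    Matrix (Fin n) (Fin n) 𝕜 →ₗ⁅𝕜⁆ ((Fin n → 𝕜) →L[𝕜] (Fin n → 𝕜)) where
  toFun A := (Matrix.toLin' A).toContinuousLinearMap
  map_add' A B := by ext1 v; simp
  map_smul' c A := by ext1 v; simp
  map_lie' {A B} := by
    ext1 v
    simp [Ring.lie_def, Matrix.mulVec_mulVec]

end Representation

/-! By the presentation of the braid group, only the braid and commutation relations for the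
operators need checking. Set E_{k,k-1} and E_{k,k+1} to `0` when out of range; since exp 0 = 1,
every generator then has the same form exp(π E_{k,k-1}) exp(s π E_{kk}) exp(-π E_{k,k+1}).

Distant generators commute because their matrix units annihilate each other. For neighbours, with X
and Y the root vectors of the middle sl₂, x = exp(-X) and y = exp Y satisfy xyx = yxy (`exp_braid`).
This Weyl element exchanges the two diagonal units and carries E₁₀ to E₂₀. The remaining commutation
rules come from exp(a) b exp(-a) = exp(ad a) b, where the series stops by nilpotency
(`exp_mul_eq_of_lie`), and with these rules both sides of the relation reach one normal form
(`braid_of_factors`, `exp_braid_of_lie`).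

In the natural representation the off-diagonal units square to zero and the diagonal ones are
idempotent, so the exponentials are explicit and multiply to the Burau matrix
(`braidOperator_naturalRep`). Homomorphisms agreeing on generators are equal. -/

/-! ### The braid relation as a word computation in a monoid -/

section Monoid

variable {M : Type*} [Monoid M]

/-- The braid relation for `g h₁ x` and `y h₂ r`, from the commutation rules between the factors. -/
theorem braid_of_factors {g h₁ h₂ x y r z v : M}
    (hxy : x * y * x = y * x * y) (hw : h₁ * (x * y * x) = x * y * x * h₂)
    (hhx : h₁ * h₂ * x = x * (h₁ * h₂)) (hhy : h₁ * h₂ * y = y * (h₁ * h₂))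
    (hh : h₁ * h₂ = h₂ * h₁)
    (hrg : r * g = g * r) (hrh : r * h₁ = h₁ * r)
    (hgx : g * x = x * g) (hgh : g * h₂ = h₂ * g)
    (hyg : y * g = g * z * y) (hzw : z * (x * y * x) = x * y * x * g)
    (hrx : r * x = x * (v * r)) (hvr : v * r * y = y * v) (hvh : v * h₂ = h₂ * v) :
    g * h₁ * x * (y * h₂ * r) * (g * h₁ * x) =
      y * h₂ * r * (g * h₁ * x) * (y * h₂ * r) := by
  -- Replaces `a` by `b` inside a word; each link of the chains below is one such replacement up to
  -- associativity.
  have e : ∀ {a b : M} (p q : M), a = b → p * (a * q) = p * (b * q) := by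
    rintro a _ p q rfl; rfl
  -- Both sides are brought to the normal form g w g (h₁h₂) h₂ v r with w = xyx.
  have hl : g * h₁ * x * (y * h₂ * r) * (g * h₁ * x) = g * (x * y * x) * g * (h₁ * h₂) * h₂ * v * r :=
    calc g * h₁ * x * (y * h₂ * r) * (g * h₁ * x)
      _ = g * h₁ * x * y * h₂ * g * r * h₁ * x := by
        simpa only [mul_assoc] using e (g * h₁ * x * y * h₂) (h₁ * x) hrg
      _ = g * h₁ * x * y * h₂ * g * h₁ * r * x := by
        simpa only [mul_assoc] using e (g * h₁ * x * y * h₂ * g) x hrh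
      _ = g * h₁ * x * y * h₂ * g * h₁ * x * v * r := by
        simpa only [mul_assoc, mul_one] using e (g * h₁ * x * y * h₂ * g * h₁) 1 hrx
      _ = g * h₁ * x * y * g * h₂ * h₁ * x * v * r := by
        simpa only [mul_assoc] using e (g * h₁ * x * y) (h₁ * x * v * r) hgh.symm
      _ = g * h₁ * x * y * g * h₁ * h₂ * x * v * r := by
        simpa only [mul_assoc] using e (g * h₁ * x * y * g) (x * v * r) hh.symm
      _ = g * h₁ * x * y * g * x * h₁ * h₂ * v * r := by
        simpa only [mul_assoc] using e (g * h₁ * x * y * g) (v * r) hhx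
      _ = g * h₁ * x * y * x * g * h₁ * h₂ * v * r := by
        simpa only [mul_assoc] using e (g * h₁ * x * y) (h₁ * h₂ * v * r) hgx
      _ = g * (x * y * x) * h₂ * g * h₁ * h₂ * v * r := by
        simpa only [mul_assoc] using e g (g * h₁ * h₂ * v * r) hw
      _ = g * (x * y * x) * g * h₂ * h₁ * h₂ * v * r := by
        simpa only [mul_assoc] using e (g * x * y * x) (h₁ * h₂ * v * r) hgh.symm
      _ = g * (x * y * x) * g * (h₁ * h₂) * h₂ * v * r := by
        simpa only [mul_assoc] using e (g * x * y * x * g) (h₂ * v * r) hh.symm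
  have hr : y * h₂ * r * (g * h₁ * x) * (y * h₂ * r) = g * (x * y * x) * g * (h₁ * h₂) * h₂ * v * r :=
    calc y * h₂ * r * (g * h₁ * x) * (y * h₂ * r)
      _ = y * h₂ * g * r * h₁ * x * y * h₂ * r := by
        simpa only [mul_assoc] using e (y * h₂) (h₁ * x * y * h₂ * r) hrg
      _ = y * h₂ * g * h₁ * r * x * y * h₂ * r := by
        simpa only [mul_assoc] using e (y * h₂ * g) (x * y * h₂ * r) hrh
      _ = y * h₂ * g * h₁ * x * v * r * y * h₂ * r := by
        simpa only [mul_assoc] using e (y * h₂ * g * h₁) (y * h₂ * r) hrx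
      _ = y * h₂ * g * h₁ * x * y * v * h₂ * r := by
        simpa only [mul_assoc] using e (y * h₂ * g * h₁ * x) (h₂ * r) hvr
      _ = y * h₂ * g * h₁ * x * y * h₂ * v * r := by
        simpa only [mul_assoc] using e (y * h₂ * g * h₁ * x * y) r hvh
      _ = y * g * h₂ * h₁ * x * y * h₂ * v * r := by
        simpa only [mul_assoc] using e y (h₁ * x * y * h₂ * v * r) hgh.symm
      _ = y * g * h₁ * h₂ * x * y * h₂ * v * r := by
        simpa only [mul_assoc] using e (y * g) (x * y * h₂ * v * r) hh.symm
      _ = y * g * x * h₁ * h₂ * y * h₂ * v * r := by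
        simpa only [mul_assoc] using e (y * g) (y * h₂ * v * r) hhx
      _ = y * g * x * y * h₁ * h₂ * h₂ * v * r := by
        simpa only [mul_assoc] using e (y * g * x) (h₂ * v * r) hhy
      -- Moving `y` past `g` costs a factor `z` but completes the word yxy = w; then zw = wg absorbs
      -- `z`.
      _ = g * z * (y * x * y) * h₁ * h₂ * h₂ * v * r := by
        simpa only [mul_assoc, one_mul] using e 1 (x * y * h₁ * h₂ * h₂ * v * r) hyg
      _ = g * (z * (x * y * x)) * h₁ * h₂ * h₂ * v * r := by
        rw [hxy]; simp only [mul_assoc]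
      _ = g * (x * y * x) * g * (h₁ * h₂) * h₂ * v * r := by
        rw [hzw]; simp only [mul_assoc]
  rw [hl, hr]

end Monoid

/-! ### Conjugation by exponentials in a Banach algebra -/

section Exponential

open NormedSpace

variable {𝔸 : Type*} [NormedRing 𝔸] [NormedAlgebra ℚ 𝔸] [CompleteSpace 𝔸]

theorem hasSum_exp_apply (T : 𝔸 →L[ℚ] 𝔸) (x : 𝔸) :
    HasSum (fun n : ℕ => ((n.factorial : ℚ)⁻¹) • (T ^ n) x) (exp T x) := by
  have h := exp_series_hasSum_exp' (𝕂 := ℚ) T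
  have hx := (ContinuousLinearMap.apply ℚ 𝔸 x).hasSum h
  exact hx

/-- Together with its right-handed counterpart, this turns the exponential of ad a = L_a - R_a into
conjugation by exp a. -/
theorem exp_mulLeft_apply (a x : 𝔸) : exp (ContinuousLinearMap.mul ℚ 𝔸 a) x = exp a * x := by
  have h : ∀ n : ℕ, (ContinuousLinearMap.mul ℚ 𝔸 a ^ n) x = a ^ n * x := by
    intro n
    induction n with
    | zero => simp
    | succ n ih => rw [pow_succ', pow_succ', mul_assoc, ← ih]; rfl
  refine (hasSum_exp_apply _ x).unique ?_
  simpa only [h, smul_mul_assoc] using (exp_series_hasSum_exp' (𝕂 := ℚ) a).mul_right x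

theorem exp_mulRight_apply (a x : 𝔸) :
    exp ((ContinuousLinearMap.mul ℚ 𝔸).flip a) x = x * exp a := by
  have h : ∀ n : ℕ, ((ContinuousLinearMap.mul ℚ 𝔸).flip a ^ n) x = x * a ^ n := by
    intro n
    induction n with
    | zero => simp
    | succ n ih => rw [pow_succ', pow_succ, ← mul_assoc, ← ih]; rfl
  refine (hasSum_exp_apply _ x).unique ?_
  simpa only [h, mul_smul_comm] using (exp_series_hasSum_exp' (𝕂 := ℚ) a).mul_left x

/-- If `ad a` is nilpotent of order three at `b`, then `exp a * b = (exp (ad a) b) * exp a`. -/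
theorem exp_mul_eq_of_lie {a b c d : 𝔸} (h₁ : ⁅a, b⁆ = c) (h₂ : ⁅a, c⁆ = d + d) (h₃ : ⁅a, d⁆ = 0) :
    exp a * b = (b + c + d) * exp a := by
  set R := (ContinuousLinearMap.mul ℚ 𝔸).flip a with hR
  set D := ContinuousLinearMap.mul ℚ 𝔸 a - R with hD
  have hDx : ∀ x, D x = ⁅a, x⁆ := fun x => by simp [hD, hR, Ring.lie_def]
  -- Left and right multiplications commute, so exp(R + D) factors.
  have hcomm : Commute R D := by
    ext x
    simp [hD, hR, mul_sub, sub_mul, mul_assoc]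
  have hb : exp D b = b + c + d := by
    have h1 : D b = c := by rw [hDx, h₁]
    have h2 : (D ^ 2) b = d + d := by
      rw [pow_two, mul_apply_eq_comp, h1, hDx, h₂]
    have h3 : ∀ n, (D ^ (n + 3)) b = 0 := by
      intro n
      rw [pow_add, mul_apply_eq_comp, pow_succ', mul_apply_eq_comp, h2,
        hDx, lie_add, h₃, add_zero, map_zero]
    refine (hasSum_exp_apply D b).unique ?_
    -- Only three terms survive, and the coefficient 1/2! turns `d + d` into `d`.
    have hs := hasSum_sum_of_ne_finset_zero (L := .unconditional ℕ)
      (f := fun n : ℕ => ((n.factorial : ℚ)⁻¹) • (D ^ n) b) (s := Finset.range 3) (by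
        intro n hn
        obtain ⟨m, rfl⟩ := Nat.exists_eq_add_of_le' (not_lt.mp (Finset.mem_range.not.mp hn))
        simp only [h3, smul_zero])
    convert hs using 1
    simp only [Finset.sum_range_succ, Finset.sum_range_zero, pow_zero, pow_one, h1, h2,
      one_apply_eq_self, Nat.factorial]
    norm_num
    module
  calc exp a * b = exp (R + D) b := by
        rw [hD, add_sub_cancel, exp_mulLeft_apply]
    _ = (b + c + d) * exp a := by
        rw [exp_add_of_commute hcomm, mul_apply_eq_comp, hb, exp_mulRight_apply]

theorem exp_mul_eq_of_lie_lie {a b c : 𝔸} (h₁ : ⁅a, b⁆ = c) (h₂ : ⁅a, c⁆ = 0) :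
    exp a * b = (b + c) * exp a := by
  simpa using exp_mul_eq_of_lie h₁ (d := 0) (by simpa using h₂) (lie_zero a)

/-- Exponentials of the simple root vectors of an `sl₂` satisfy the braid relation. -/
theorem exp_braid {X Y H : 𝔸} (hXY : ⁅X, Y⁆ = H) (hHX : ⁅H, X⁆ = X + X) (hHY : ⁅H, Y⁆ = -(Y + Y)) :
    exp (-X) * exp Y * exp (-X) = exp Y * exp (-X) * exp Y := by
  have hYX : ⁅Y, X⁆ = -H := by rw [← lie_skew, hXY]
  have hXH : ⁅X, H⁆ = -(X + X) := by rw [← lie_skew, hHX]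
  have hYH : ⁅Y, H⁆ = Y + Y := by rw [← lie_skew, hHY, neg_neg]
  have e1 : exp (-X) * -X = -X * exp (-X) := ((Commute.refl (-X)).exp_left).eq
  have e2 : exp Y * -X = (-X + H + Y) * exp Y :=
    exp_mul_eq_of_lie (by rw [lie_neg, hYX, neg_neg]) hYH (lie_self Y)
  -- Here ad(-X) sends -X + H + Y to 2X - H and then to -2X, so the exponential adds X + X - H and
  -- -X, leaving Y.
  have e3 : exp (-X) * (-X + H + Y) = Y * exp (-X) := by
    have := exp_mul_eq_of_lie (a := -X) (b := -X + H + Y) (c := X + X - H) (d := -X)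
      (by simp only [neg_lie, lie_add, lie_self, hXH, hXY]; abel)
      (by simp only [neg_lie, lie_sub, lie_add, lie_self, hXH]; abel)
      (by simp)
    rw [this]; congr 1; abel
  have hs : SemiconjBy (exp (-X) * exp Y * exp (-X)) (-X) Y := by
    change _ * _ = _ * _
    rw [mul_assoc, e1, ← mul_assoc, mul_assoc (exp (-X)), e2, ← mul_assoc, e3]
    simp only [mul_assoc]
  -- As xyx carries -X to Y, it carries x to y: (xyx)x = y(xyx) = (yxy)x, and x cancels.
  refine (isUnit_exp (-X)).mul_right_cancel ?_
  simpa only [mul_assoc] using hs.exp_right.eq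

theorem exp_of_mul_self_eq_zero {a : 𝔸} (h : a * a = 0) : exp a = 1 + a := by
  refine (exp_series_hasSum_exp' (𝕂 := ℚ) a).unique ?_
  have hs := hasSum_sum_of_ne_finset_zero (L := .unconditional ℕ)
    (f := fun n : ℕ => ((n.factorial : ℚ)⁻¹) • a ^ n) (s := Finset.range 2) (by
      intro n hn
      obtain ⟨m, rfl⟩ := Nat.exists_eq_add_of_le' (not_lt.mp (Finset.mem_range.not.mp hn))
      simp only [pow_add, pow_two, h, mul_zero, smul_zero])
  simpa [Finset.sum_range_succ] using hs

/-- The braid relation for the operators attached to consecutive diagonal entries: `p`, `q`, `X`,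
`Y`, `e₁`, `e₂`, `z`, `m` play the parts of `E₁₀`, `E₂₃`, `E₁₂`, `E₂₁`, `E₁₁`, `E₂₂`, `E₂₀`,
`E₁₃`. -/
theorem exp_braid_of_lie {𝕜 : Type*} [CommRing 𝕜] [Algebra 𝕜 𝔸] (s : 𝕜) {p q X Y e₁ e₂ z m : 𝔸}
    (hXY : ⁅X, Y⁆ = e₁ - e₂)
    (h1X : ⁅e₁, X⁆ = X) (h1Y : ⁅e₁, Y⁆ = -Y) (h2X : ⁅e₂, X⁆ = -X) (h2Y : ⁅e₂, Y⁆ = Y)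
    (h12 : ⁅e₁, e₂⁆ = 0) (h2p : ⁅e₂, p⁆ = 0) (h1q : ⁅e₁, q⁆ = 0)
    (hpX : ⁅p, X⁆ = 0) (hpq : ⁅p, q⁆ = 0) (hYq : ⁅Y, q⁆ = 0)
    (hYp : ⁅Y, p⁆ = z) (hXq : ⁅X, q⁆ = m) (hpz : ⁅p, z⁆ = 0) (hYz : ⁅Y, z⁆ = 0) (hXz : ⁅X, z⁆ = p)
    (hmq : ⁅m, q⁆ = 0) (hXm : ⁅X, m⁆ = 0) (hYm : ⁅Y, m⁆ = q) (h2m : ⁅e₂, m⁆ = 0) :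
    exp p * exp (s • e₁) * exp (-X) * (exp Y * exp (s • e₂) * exp (-q)) *
        (exp p * exp (s • e₁) * exp (-X)) =
      exp Y * exp (s • e₂) * exp (-q) * (exp p * exp (s • e₁) * exp (-X)) *
        (exp Y * exp (s • e₂) * exp (-q)) := by
  have hX1 : ⁅X, e₁⁆ = -X := by rw [← lie_skew, h1X]
  have hX2 : ⁅X, e₂⁆ = X := by rw [← lie_skew, h2X, neg_neg]
  have hY1 : ⁅Y, e₁⁆ = Y := by rw [← lie_skew, h1Y, neg_neg]
  have hY2 : ⁅Y, e₂⁆ = -Y := by rw [← lie_skew, h2Y]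
  have hYX : ⁅Y, X⁆ = e₂ - e₁ := by rw [← lie_skew, hXY, neg_sub]
  have hXp : ⁅X, p⁆ = 0 := by rw [← lie_skew, hpX, neg_zero]
  have hh : Commute (s • e₁) (s • e₂) := ((commute_iff_lie_eq.mpr h12).smul_left s).smul_right s
  have hhX : Commute (s • e₁ + s • e₂) X := by
    rw [← smul_add]
    exact (commute_iff_lie_eq.mpr (by rw [add_lie, h1X, h2X, add_neg_cancel])).smul_left s
  have hhY : Commute (s • e₁ + s • e₂) Y := by
    rw [← smul_add]
    exact (commute_iff_lie_eq.mpr (by rw [add_lie, h1Y, h2Y, neg_add_cancel])).smul_left s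
  -- The three factors move e₂ to e₂ - X, then to e₁ - X, then to e₁.
  have hw : SemiconjBy (exp (-X) * exp Y * exp (-X)) e₂ e₁ := by
    have w1 : SemiconjBy (exp (-X)) e₂ (e₂ + -X) :=
      exp_mul_eq_of_lie_lie (by rw [neg_lie, hX2]) (by simp)
    have w2 : SemiconjBy (exp Y) (e₂ + -X) (e₁ + -X) := by
      have := exp_mul_eq_of_lie (a := Y) (b := e₂ + -X) (c := -Y + e₁ - e₂) (d := Y)
        (by simp only [lie_add, lie_neg, hY2, hYX]; abel)
        (by simp only [lie_add, lie_sub, lie_neg, lie_self, hY1, hY2]; abel)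
        (lie_self Y)
      refine this.trans ?_
      congr 1; abel
    have w3 : SemiconjBy (exp (-X)) (e₁ + -X) e₁ := by
      have := exp_mul_eq_of_lie_lie (a := -X) (b := e₁ + -X) (c := X)
        (by simp only [lie_add, neg_lie, lie_self, hX1]; abel) (by simp)
      refine this.trans ?_
      congr 1; abel
    exact (w3.mul_left w2).mul_left w1
  -- The three factors move p to p, then to p + z, then to z.
  have hz : SemiconjBy (exp (-X) * exp Y * exp (-X)) p z := by
    have w1 : SemiconjBy (exp (-X)) p p := (commute_iff_lie_eq.mpr hXp).neg_left.exp_left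
    have w2 : SemiconjBy (exp Y) p (p + z) := exp_mul_eq_of_lie_lie hYp hYz
    have w3 : SemiconjBy (exp (-X)) (p + z) z := by
      have := exp_mul_eq_of_lie_lie (a := -X) (b := p + z) (c := -p)
        (by simp only [lie_add, neg_lie, hXp, hXz]; abel) (by simp [hXp])
      refine this.trans ?_
      congr 1; abel
    exact (w3.mul_left w2).mul_left w1
  refine braid_of_factors (z := exp z) (v := exp (-m)) ?_ ?_ ?_ ?_ ?_ ?_ ?_ ?_ ?_ ?_ ?_ ?_ ?_ ?_
  · refine exp_braid hXY ?_ ?_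
    · rw [sub_lie, h1X, h2X, sub_neg_eq_add]
    · rw [sub_lie, h1Y, h2Y]; abel
  · have : SemiconjBy (exp (-X) * exp Y * exp (-X)) (s • e₂) (s • e₁) := by
      change _ * _ = _ * _
      rw [mul_smul_comm, hw.eq, smul_mul_assoc]
    exact this.exp_right.eq.symm
  · rw [← exp_add_of_commute hh]
    exact hhX.neg_right.exp.eq
  · rw [← exp_add_of_commute hh]
    exact hhY.exp.eq
  · exact hh.exp.eq
  · exact (commute_iff_lie_eq.mpr hpq).symm.neg_left.exp.eq
  · exact ((commute_iff_lie_eq.mpr h1q).symm.neg_left.smul_right s).exp.eq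
  · exact (commute_iff_lie_eq.mpr hpX).neg_right.exp.eq
  · exact ((commute_iff_lie_eq.mpr h2p).symm.smul_right s).exp.eq
  · have w2 : SemiconjBy (exp Y) p (p + z) := exp_mul_eq_of_lie_lie hYp hYz
    rw [← exp_add_of_commute (commute_iff_lie_eq.mpr hpz)]
    exact w2.exp_right.eq
  · exact hz.exp_right.eq.symm
  · rw [← exp_add_of_commute (commute_iff_lie_eq.mpr hmq).neg_left.neg_right]
    have w : SemiconjBy (exp (-X)) (-m + -q) (-q) := by
      have := exp_mul_eq_of_lie_lie (a := -X) (b := -m + -q) (c := m)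
        (by simp only [lie_add, neg_lie, lie_neg, hXm, hXq]; abel) (by simp [hXm])
      refine this.trans ?_
      congr 1; abel
    exact w.exp_right.eq.symm
  · rw [← exp_add_of_commute (commute_iff_lie_eq.mpr hmq).neg_left.neg_right]
    have w : SemiconjBy (exp Y) (-m) (-m + -q) :=
      exp_mul_eq_of_lie_lie (by rw [lie_neg, hYm]) (by rw [lie_neg, hYq, neg_zero])
    exact w.exp_right.eq.symm
  · exact ((commute_iff_lie_eq.mpr h2m).symm.neg_left.smul_right s).exp.eq

end Exponential

/-! ### Matrix units next to the diagonal -/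

section MatrixUnits

open NormedSpace

variable {𝕜 : Type*} [RCLike 𝕜] {n : ℕ}

/-- The matrix unit `E_{i,i-1}`, or `0` for the first index. -/
def lowerUnit (𝕜 : Type*) [RCLike 𝕜] {n : ℕ} (i : Fin n) : Matrix (Fin n) (Fin n) 𝕜 :=
  if 0 < (i : ℕ) then Matrix.single i ⟨(i : ℕ) - 1, (Nat.sub_le _ _).trans_lt i.2⟩ 1 else 0

/-- The matrix unit `E_{i,i+1}`, or `0` for the last index. -/
def upperUnit (𝕜 : Type*) [RCLike 𝕜] {n : ℕ} (i : Fin n) : Matrix (Fin n) (Fin n) 𝕜 :=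
  if h : (i : ℕ) + 1 < n then Matrix.single i ⟨(i : ℕ) + 1, h⟩ 1 else 0

theorem lowerUnit_eq_single {i j : Fin n} (h : (i : ℕ) + 1 = j) :
    lowerUnit 𝕜 j = Matrix.single j i 1 := by
  rw [lowerUnit, if_pos (by omega)]
  congr 1
  exact Fin.ext (by simp only; omega)

theorem upperUnit_eq_single {i j : Fin n} (h : (i : ℕ) + 1 = j) :
    upperUnit 𝕜 i = Matrix.single i j 1 := by
  rw [upperUnit, dif_pos (by omega)]
  congr 1
  exact Fin.ext h

theorem lowerUnit_eq_zero_or (𝕜 : Type*) [RCLike 𝕜] (j : Fin n) :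
    ((j : ℕ) = 0 ∧ lowerUnit 𝕜 j = 0) ∨
      ∃ i : Fin n, (i : ℕ) + 1 = j ∧ lowerUnit 𝕜 j = Matrix.single j i 1 := by
  by_cases h : 0 < (j : ℕ)
  · have h' : (j : ℕ) - 1 + 1 = j := Nat.sub_add_cancel h
    exact Or.inr ⟨⟨j - 1, by omega⟩, h', lowerUnit_eq_single h'⟩
  · exact Or.inl ⟨by omega, if_neg h⟩

theorem upperUnit_eq_zero_or (𝕜 : Type*) [RCLike 𝕜] (i : Fin n) :
    ((i : ℕ) + 1 = n ∧ upperUnit 𝕜 i = 0) ∨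
      ∃ j : Fin n, (i : ℕ) + 1 = j ∧ upperUnit 𝕜 i = Matrix.single i j 1 := by
  by_cases h : (i : ℕ) + 1 < n
  · exact Or.inr ⟨⟨i + 1, h⟩, rfl, upperUnit_eq_single rfl⟩
  · exact Or.inl ⟨by omega, dif_neg h⟩

/-! ### Braid group relations for an arbitrary bounded representation -/

section BanachSpace

variable {V : Type*} [NormedAddCommGroup V] [NormedSpace 𝕜 V]
  (π : Matrix (Fin n) (Fin n) 𝕜 →ₗ⁅𝕜⁆ (V →L[𝕜] V)) (s : 𝕜)

/-- Absent end factors become exp 0 = 1, so later arguments need no separate formula for the first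
and last generators. -/
theorem braidOperator_eq (k : Fin n) :
    braidOperator π s k =
      exp (π (lowerUnit 𝕜 k)) * exp (s • π (Matrix.single k k 1)) *
        exp (-π (upperUnit 𝕜 k)) := by
  rw [braidOperator, glE]
  congr 1
  · congr 1
    split_ifs with h
    · rw [lowerUnit_eq_single (i := ⟨(k : ℕ) - 1, by omega⟩) (Nat.sub_add_cancel h), serreY]
      congr 3
      exact Fin.ext (Nat.sub_add_cancel h)
    · rw [lowerUnit, if_neg h, map_zero, exp_zero]
  · split_ifs with h
    · rw [upperUnit, dif_pos h, serreX]
    · rw [upperUnit, dif_neg h, map_zero, neg_zero, exp_zero]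

theorem isUnit_braidOperator [CompleteSpace V] (k : Fin n) : IsUnit (braidOperator π s k) := by
  let : NormedAlgebra ℚ (V →L[𝕜] V) := NormedAlgebra.restrictScalars ℚ 𝕜 _
  rw [braidOperator_eq]
  exact ((isUnit_exp _).mul (isUnit_exp _)).mul (isUnit_exp _)

theorem braidOperator_comm {k l : Fin n} (h : (k : ℕ) + 2 ≤ l) :
    Commute (braidOperator π s k) (braidOperator π s l) := by
  have key : ∀ {A B : Matrix (Fin n) (Fin n) 𝕜}, A * B = 0 → B * A = 0 →
      Commute (π A) (π B) := by
    intro A B h1 h2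
    rw [commute_iff_lie_eq, ← LieHom.map_lie, Ring.lie_def, h1, h2, sub_zero, map_zero]
  -- The units are E_{k,a} with a ≤ k + 1 < l and E_{l,b} with b ≥ l - 1 > k, so both products
  -- vanish.
  have hc : ∀ A ∈ ({lowerUnit 𝕜 k, Matrix.single k k 1, upperUnit 𝕜 k} : Set _),
      ∀ B ∈ ({lowerUnit 𝕜 l, Matrix.single l l 1, upperUnit 𝕜 l} : Set _),
      Commute (π A) (π B) := by
    have hA : ∀ A ∈ ({lowerUnit 𝕜 k, Matrix.single k k 1, upperUnit 𝕜 k} : Set _),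
        A = 0 ∨ ∃ a : Fin n, (a : ℕ) ≤ k + 1 ∧ A = Matrix.single k a 1 := by
      rintro A (rfl | rfl | rfl)
      · rcases lowerUnit_eq_zero_or 𝕜 k with ⟨-, h0⟩ | ⟨a, ha, h0⟩
        · exact Or.inl h0
        · exact Or.inr ⟨a, by omega, h0⟩
      · exact Or.inr ⟨k, by omega, rfl⟩
      · rcases upperUnit_eq_zero_or 𝕜 k with ⟨-, h0⟩ | ⟨a, ha, h0⟩
        · exact Or.inl h0
        · exact Or.inr ⟨a, by omega, h0⟩
    have hB : ∀ B ∈ ({lowerUnit 𝕜 l, Matrix.single l l 1, upperUnit 𝕜 l} : Set _),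
        B = 0 ∨ ∃ b : Fin n, (l : ℕ) ≤ b + 1 ∧ B = Matrix.single l b 1 := by
      rintro B (rfl | rfl | rfl)
      · rcases lowerUnit_eq_zero_or 𝕜 l with ⟨-, h0⟩ | ⟨b, hb, h0⟩
        · exact Or.inl h0
        · exact Or.inr ⟨b, by omega, h0⟩
      · exact Or.inr ⟨l, by omega, rfl⟩
      · rcases upperUnit_eq_zero_or 𝕜 l with ⟨-, h0⟩ | ⟨b, hb, h0⟩
        · exact Or.inl h0
        · exact Or.inr ⟨b, by omega, h0⟩
    intro A hA' B hB'
    rcases hA A hA' with rfl | ⟨a, ha, rfl⟩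
    · exact key (zero_mul _) (mul_zero _)
    rcases hB B hB' with rfl | ⟨b, hb, rfl⟩
    · exact key (mul_zero _) (zero_mul _)
    exact key (Matrix.single_mul_single_of_ne _ _ _ _ (by rintro rfl; omega) _)
      (Matrix.single_mul_single_of_ne _ _ _ _ (by rintro rfl; omega) _)
  have hr : ∀ {T : V →L[𝕜] V},
      (∀ B ∈ ({lowerUnit 𝕜 l, Matrix.single l l 1, upperUnit 𝕜 l} : Set _), Commute T (π B)) →
      Commute T (braidOperator π s l) := by
    intro T hT
    rw [braidOperator_eq]
    exact ((hT _ (by simp)).exp_right.mul_right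
      ((hT _ (by simp)).smul_right s).exp_right).mul_right (hT _ (by simp)).neg_right.exp_right
  rw [braidOperator_eq π s k]
  exact ((hr (hc _ (by simp))).exp_left.mul_left
    ((hr (hc _ (by simp))).smul_left s).exp_left).mul_left (hr (hc _ (by simp))).neg_left.exp_left

theorem braidOperator_braid [CompleteSpace V] {i j : Fin n} (h : (i : ℕ) + 1 = j) :
    braidOperator π s i * braidOperator π s j * braidOperator π s i =
      braidOperator π s j * braidOperator π s i * braidOperator π s j := by
  let : NormedAlgebra ℚ (V →L[𝕜] V) := NormedAlgebra.restrictScalars ℚ 𝕜 _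
  rw [braidOperator_eq, braidOperator_eq, upperUnit_eq_single h, lowerUnit_eq_single h]
  have hij : i ≠ j := by rintro rfl; omega
  have hji := hij.symm
  -- `z` is the bracket itself: E_{j,i-1}, or `0` when i is the first index. Keeping it abstract
  -- lets both cases share what follows; `m` below is handled likewise.
  obtain ⟨z, hp⟩ : ∃ z, ⁅Matrix.single j i (1 : 𝕜), lowerUnit 𝕜 i⁆ = z ∧
      ⁅Matrix.single j j (1 : 𝕜), lowerUnit 𝕜 i⁆ = 0 ∧ ⁅lowerUnit 𝕜 i, Matrix.single i j (1 : 𝕜)⁆ = 0 ∧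
      ⁅lowerUnit 𝕜 i, upperUnit 𝕜 j⁆ = 0 ∧ ⁅lowerUnit 𝕜 i, z⁆ = 0 ∧
      ⁅Matrix.single j i (1 : 𝕜), z⁆ = 0 ∧ ⁅Matrix.single i j (1 : 𝕜), z⁆ = lowerUnit 𝕜 i := by
    refine ⟨_, rfl, ?_⟩
    rcases lowerUnit_eq_zero_or 𝕜 i with ⟨-, hp⟩ | ⟨a, ha, hp⟩
    · simp [hp]
    have hai : a ≠ i := by rintro rfl; omega
    have haj : a ≠ j := by rintro rfl; omega
    rw [hp]
    rcases upperUnit_eq_zero_or 𝕜 j with ⟨-, hq⟩ | ⟨b, hb, hq⟩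
    · simp [hq, Ring.lie_def, hai, haj, hij, hji]
    have hbi : b ≠ i := by rintro rfl; omega
    simp [hq, Ring.lie_def, hai, haj, hij, hji, hbi]
  obtain ⟨m, hq⟩ : ∃ m, ⁅Matrix.single i j (1 : 𝕜), upperUnit 𝕜 j⁆ = m ∧
      ⁅Matrix.single i i (1 : 𝕜), upperUnit 𝕜 j⁆ = 0 ∧ ⁅Matrix.single j i (1 : 𝕜), upperUnit 𝕜 j⁆ = 0 ∧
      ⁅m, upperUnit 𝕜 j⁆ = 0 ∧ ⁅Matrix.single i j (1 : 𝕜), m⁆ = 0 ∧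
      ⁅Matrix.single j i (1 : 𝕜), m⁆ = upperUnit 𝕜 j ∧ ⁅Matrix.single j j (1 : 𝕜), m⁆ = 0 := by
    refine ⟨_, rfl, ?_⟩
    rcases upperUnit_eq_zero_or 𝕜 j with ⟨-, hq⟩ | ⟨b, hb, hq⟩
    · simp [hq]
    have hbi : b ≠ i := by rintro rfl; omega
    have hbj : b ≠ j := by rintro rfl; omega
    rw [hq]
    simp [Ring.lie_def, hbi, hbj, hij, hji]
  obtain ⟨hYp, h2p, hpX, hpq, hpz, hYz, hXz⟩ := hp
  obtain ⟨hXq, h1q, hYq, hmq, hXm, hYm, h2m⟩ := hq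
  -- Each bracket hypothesis is pulled back through `π` to an identity between matrices.
  apply exp_braid_of_lie s (z := π z) (m := π m) <;> rw [← LieHom.map_lie]
  · simp [Ring.lie_def]
  · simp [Ring.lie_def, hji]
  · simp [Ring.lie_def, hij]
  · simp [Ring.lie_def, hji]
  · simp [Ring.lie_def, hij]
  · simp [Ring.lie_def, hij, hji]
  · rw [h2p, map_zero]
  · rw [h1q, map_zero]
  · rw [hpX, map_zero]
  · rw [hpq, map_zero]
  · rw [hYq, map_zero]
  · rw [hYp]
  · rw [hXq]
  · rw [hpz, map_zero]
  · rw [hYz, map_zero]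
  · rw [hXz]
  · rw [hmq, map_zero]
  · rw [hXm, map_zero]
  · rw [hYm]
  · rw [h2m, map_zero]

theorem exists_braidGroup_hom [CompleteSpace V] :
    ∃ ρ : BraidGroup (n + 1) →* (V →L[𝕜] V)ˣ,
      ∀ k : Fin n, (ρ (BraidGroup.σ k) : V →L[𝕜] V) = braidOperator π s k := by
  have hf : ∀ r ∈ {r | BraidRelator (n + 1) r},
      FreeGroup.lift (fun k : Fin n => (isUnit_braidOperator π s k).unit) r = 1 := by
    rintro r (⟨i, j, h⟩ | ⟨i, j, h⟩)
    · simp only [map_mul, map_inv, FreeGroup.lift_apply_of, mul_inv_eq_one]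
      exact Units.ext (braidOperator_braid (n := n) π s h)
    · simp only [map_mul, map_inv, FreeGroup.lift_apply_of, mul_inv_eq_one]
      exact Units.ext (braidOperator_comm (n := n) π s h).eq
  exact ⟨PresentedGroup.toGroup hf, fun k => congrArg Units.val (PresentedGroup.toGroup.of hf)⟩

end BanachSpace

/-! ### The natural representation and the Burau matrices -/

section NaturalRep

theorem naturalRep_apply (A : Matrix (Fin n) (Fin n) 𝕜) (v : Fin n → 𝕜) :
    naturalRep 𝕜 n A v = A.mulVec v := rfl

/-- Unlike a general Lie algebra representation, this one respects products, so exponentials can be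
computed on matrices. -/
theorem naturalRep_mul (A B : Matrix (Fin n) (Fin n) 𝕜) :
    naturalRep 𝕜 n A * naturalRep 𝕜 n B = naturalRep 𝕜 n (A * B) := by
  ext1 v
  exact Matrix.mulVec_mulVec v A B

theorem naturalRep_one : naturalRep 𝕜 n 1 = 1 := by
  ext1 v
  exact Matrix.one_mulVec v

theorem exp_naturalRep {A : Matrix (Fin n) (Fin n) 𝕜} (h : A * A = 0) :
    exp (naturalRep 𝕜 n A) = naturalRep 𝕜 n (1 + A) := by
  let : NormedAlgebra ℚ ((Fin n → 𝕜) →L[𝕜] (Fin n → 𝕜)) := NormedAlgebra.restrictScalars ℚ 𝕜 _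
  rw [exp_of_mul_self_eq_zero (by rw [naturalRep_mul, h, map_zero]), map_add, naturalRep_one]

/-- P intertwines sP with the scalar s, and 1 - P intertwines it with 0. Hence P exp(sP) = eˢP and
(1 - P) exp(sP) = 1 - P; adding the two gives the formula. -/
theorem exp_smul_of_mul_self {A : Type*} [NormedRing A] [NormedAlgebra 𝕜 A] [CompleteSpace A]
    {P : A} (h : P * P = P) (s : 𝕜) : exp (s • P) = 1 + (exp s - 1) • P := by
  let : NormedAlgebra ℚ A := NormedAlgebra.restrictScalars ℚ 𝕜 _
  have h1 : SemiconjBy P (s • P) (algebraMap 𝕜 A s) := by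
    change _ * _ = _ * _
    rw [mul_smul_comm, h, Algebra.smul_def]
  have h2 : SemiconjBy (1 - P) (s • P) 0 := by
    change _ * _ = _ * _
    rw [mul_smul_comm, sub_mul, h, one_mul, sub_self, smul_zero, zero_mul]
  have e1 := h1.exp_right.eq
  have e2 := h2.exp_right.eq
  rw [← algebraMap_exp_comm, ← Algebra.smul_def] at e1
  rw [exp_zero, one_mul, sub_mul, one_mul, e1] at e2
  rw [sub_eq_iff_eq_add.mp e2]
  module

theorem exp_smul_naturalRep {A : Matrix (Fin n) (Fin n) 𝕜} (h : A * A = A) (s : 𝕜) :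
    exp (s • naturalRep 𝕜 n A) = naturalRep 𝕜 n (1 + (exp s - 1) • A) := by
  have hA : naturalRep 𝕜 n A * naturalRep 𝕜 n A = naturalRep 𝕜 n A := by rw [naturalRep_mul, h]
  rw [map_add, map_smul, naturalRep_one]
  exact exp_smul_of_mul_self hA s

theorem burauDiff_eq (t : 𝕜) (k : Fin n) :
    burauDiff t k = lowerUnit 𝕜 k + (-t - 1) • Matrix.single k k 1 + t • upperUnit 𝕜 k := by
  ext i j
  have hl : lowerUnit 𝕜 k i j = if i = k ∧ (j : ℕ) + 1 = k then 1 else 0 := by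
    rcases lowerUnit_eq_zero_or 𝕜 k with ⟨h0, h⟩ | ⟨a, ha, h⟩
    · rw [h, if_neg (by omega), Matrix.zero_apply]
    · rw [h, Matrix.single_apply]
      exact if_congr (by rw [Fin.ext_iff, Fin.ext_iff, Fin.ext_iff]; omega) rfl rfl
  have hu : upperUnit 𝕜 k i j = if i = k ∧ (j : ℕ) = k + 1 then 1 else 0 := by
    rcases upperUnit_eq_zero_or 𝕜 k with ⟨h0, h⟩ | ⟨a, ha, h⟩
    · rw [h, if_neg (by omega), Matrix.zero_apply]
    · rw [h, Matrix.single_apply]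
      exact if_congr (by rw [Fin.ext_iff, Fin.ext_iff, Fin.ext_iff]; omega) rfl rfl
  rw [Matrix.add_apply, Matrix.add_apply, Matrix.smul_apply, Matrix.smul_apply, hl, hu,
    Matrix.single_apply, burauDiff, Matrix.vecMulVec_apply, Pi.sub_apply, Pi.single_apply,
    Pi.single_apply, burauRow]
  by_cases hi : i = k
  · simp only [hi, true_and, if_true, Fin.ext_iff, smul_eq_mul, one_mul]
    rcases lt_trichotomy (j : ℕ) k with hj | hj | hj
    · simp [hj.ne, hj.ne', show ¬ (j : ℕ) = k + 1 by omega]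
    · simp [hj]
    · simp [hj.ne, hj.ne', show ¬ (j : ℕ) + 1 = k by omega]
  · simp [hi, Ne.symm hi]

theorem lowerUnit_mul_lowerUnit (k : Fin n) : lowerUnit 𝕜 k * lowerUnit 𝕜 k = 0 := by
  rcases lowerUnit_eq_zero_or 𝕜 k with ⟨-, h⟩ | ⟨a, ha, h⟩
  · rw [h, zero_mul]
  · rw [h, Matrix.single_mul_single_of_ne _ _ _ _ (by rintro rfl; omega)]

theorem upperUnit_mul_upperUnit (k : Fin n) : upperUnit 𝕜 k * upperUnit 𝕜 k = 0 := by
  rcases upperUnit_eq_zero_or 𝕜 k with ⟨-, h⟩ | ⟨a, ha, h⟩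
  · rw [h, zero_mul]
  · rw [h, Matrix.single_mul_single_of_ne _ _ _ _ (by rintro rfl; omega)]

theorem lowerUnit_mul_single (k : Fin n) : lowerUnit 𝕜 k * Matrix.single k k 1 = 0 := by
  rcases lowerUnit_eq_zero_or 𝕜 k with ⟨-, h⟩ | ⟨a, ha, h⟩
  · rw [h, zero_mul]
  · rw [h, Matrix.single_mul_single_of_ne _ _ _ _ (by rintro rfl; omega)]

theorem single_mul_upperUnit (k : Fin n) :
    Matrix.single k k 1 * upperUnit 𝕜 k = upperUnit 𝕜 k := by
  rcases upperUnit_eq_zero_or 𝕜 k with ⟨-, h⟩ | ⟨a, ha, h⟩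
  · rw [h, mul_zero]
  · rw [h, Matrix.single_mul_single_same, one_mul]

/-- With L, E, U the lower, diagonal and upper units of row k, expand (1 + L)(1 + (-t - 1)E)(1 - U)
using LE = LU = 0 and EU = U. The coefficient of U is -1 + (t + 1) = t. -/
theorem braidOperator_naturalRep {s t : 𝕜} (hst : exp s = -t) (k : Fin n) :
    braidOperator (naturalRep 𝕜 n) s k = naturalRep 𝕜 n (burauMatrix t k) := by
  have hLU : lowerUnit 𝕜 k * upperUnit 𝕜 k = 0 := by
    rw [← single_mul_upperUnit, ← mul_assoc, lowerUnit_mul_single, zero_mul]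
  rw [braidOperator_eq, exp_naturalRep (lowerUnit_mul_lowerUnit k),
    exp_smul_naturalRep (by rw [Matrix.single_mul_single_same, one_mul]), ← map_neg,
    exp_naturalRep (by rw [neg_mul_neg, upperUnit_mul_upperUnit]), naturalRep_mul, naturalRep_mul,
    hst, burauMatrix_eq, burauDiff_eq]
  congr 1
  simp only [add_mul, mul_add, one_mul, mul_one, mul_neg, smul_mul_assoc, mul_smul_comm,
    lowerUnit_mul_single, hLU, single_mul_upperUnit, zero_mul]
  module

end NaturalRep

end MatrixUnits


theorem mainTheorem2 {𝕜 : Type*} [RCLike 𝕜] (n : ℕ) (s : 𝕜) :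
    (∀ (V : Type*) [NormedAddCommGroup V] [NormedSpace 𝕜 V] [CompleteSpace V]
      (π : Matrix (Fin n) (Fin n) 𝕜 →ₗ⁅𝕜⁆ (V →L[𝕜] V)),
      ∃ ρ : BraidGroup (n + 1) →* (V →L[𝕜] V)ˣ,
        ∀ k : Fin n, (ρ (BraidGroup.σ k) : V →L[𝕜] V) = braidOperator π s k) ∧
    (∀ t : 𝕜ˣ, NormedSpace.exp s = -(t : 𝕜) →
      ∃ ρ : BraidGroup (n + 1) →* ((Fin n → 𝕜) →L[𝕜] (Fin n → 𝕜))ˣ,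
        (∀ k : Fin n, (ρ (BraidGroup.σ k) : (Fin n → 𝕜) →L[𝕜] (Fin n → 𝕜)) =
          braidOperator (naturalRep 𝕜 n) s k) ∧
        ∀ (g : BraidGroup (n + 1)) (v : Fin n → 𝕜),
          (ρ g : (Fin n → 𝕜) →L[𝕜] (Fin n → 𝕜)) v =
            (reducedBurau n t g : Matrix (Fin n) (Fin n) 𝕜).mulVec v) := by
  refine ⟨fun V _ _ _ π => exists_braidGroup_hom π s, fun t hst => ?_⟩
  obtain ⟨ρ, hρ⟩ := exists_braidGroup_hom (naturalRep 𝕜 n) s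
  refine ⟨ρ, hρ, fun g v => ?_⟩
  let ψ : Matrix (Fin n) (Fin n) 𝕜 →* ((Fin n → 𝕜) →L[𝕜] (Fin n → 𝕜)) :=
    { toFun := naturalRep 𝕜 n
      map_one' := naturalRep_one
      map_mul' := fun A B => (naturalRep_mul A B).symm }
  -- Multiplicativity of the natural representation makes the right side a group homomorphism, so
  -- comparison on generators suffices.
  have hf : ρ = (Units.map ψ).comp (reducedBurau n t) := by
    refine PresentedGroup.ext fun k : Fin n => Units.ext ?_
    change (ρ (BraidGroup.σ k) : (Fin n → 𝕜) →L[𝕜] (Fin n → 𝕜)) =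
      naturalRep 𝕜 n (reducedBurau n t (BraidGroup.σ k) : Matrix (Fin n) (Fin n) 𝕜)
    rw [hρ, reducedBurau_σ, braidOperator_naturalRep hst]
  rw [hf]
  exact naturalRep_apply _ v
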